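/- Let $X$ be a complex Banach space and let $L(X)$ be the algebra of bounded linear operators on $X$. An operator $T$ is upper semi-Fredholm if $\dim\ker T<\infty$ and its range is closed; its index is then $\operatorname{ind}(T)=\dim\ker T-\operatorname{codim} \operatorname{ran} T\in\mathbb Z\cup\{-\infty\}$. It is upper semi-Weyl if it is upper semi-Fredholm with $\operatorname{ind}(T)\le 0$, and Weyl if it is Fredholm with $\operatorname{ind}(T)=0$. For $n\ge 0$ let $T_{[n]}$ be the restriction of $T$ to $\operatorname{ran}(T^n)$, regarded as an operator from $\operatorname{ran}(T^n)$ into itself. $T$ is upper semi-B-Weyl (respectively B-Weyl) if for some integer $n\ge 0$ the space $\operatorname{ran}(T^n)$ is closed and $T_{[n]}$ is upper semi-Weyl (respectively Weyl). The spectra $\sigma_{uw}(T)$, $\sigma_{w}(T)$, $\sigma_{ubw}(T)$, $\sigma_{bw}(T)$ are the sets of all $\lambda\in\mathbb C$ such that $T-\lambda I$ is not upper semi-Weyl, not Weyl, not upper semi-B-Weyl, not B-Weyl, respectively. Then for every $T\in L(X)$, $$\sigma_{uw}(T)=\sigma_{w}(T)\iff \sigma_{ubw}(T)=\sigma_{bw}(T).$$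 -/

import Mathlib

noncomputable section

namespace BWeyl

/-- A continuous linear map is upper semi-Fredholm if its kernel is finite dimensional and its
range is closed. -/
structure IsUpperSemiFredholm {E F : Type*} [NormedAddCommGroup E] [NormedSpace ℂ E]
    [NormedAddCommGroup F] [NormedSpace ℂ F] (T : E →L[ℂ] F) : Prop where
  finite_ker : FiniteDimensional ℂ T.ker
  isClosed_range : IsClosed (T.range : Set F)

open Classical in
/-- The index `dim ker T - codim range T` of an upper semi-Fredholm operator, with values in
`ℤ ∪ {-∞}`: it is `-∞` (written `⊥`) when the range has infinite codimension. Only used for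
operators with finite-dimensional kernel. -/
def semiFredholmIndex {E F : Type*} [NormedAddCommGroup E] [NormedSpace ℂ E]
    [NormedAddCommGroup F] [NormedSpace ℂ F] (T : E →L[ℂ] F) : WithBot ℤ :=
  if FiniteDimensional ℂ (F ⧸ T.range) then
    (T.toLinearMap.index : WithBot ℤ)
  else ⊥

variable {X : Type*} [NormedAddCommGroup X] [NormedSpace ℂ X]

/-- Upper semi-Weyl: upper semi-Fredholm of index `≤ 0`. -/
def IsUpperSemiWeyl (T : X →L[ℂ] X) : Prop :=
  IsUpperSemiFredholm T ∧ semiFredholmIndex T ≤ 0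

/-- Weyl: Fredholm of index `0`. -/
def IsWeyl (T : X →L[ℂ] X) : Prop :=
  T.IsFredholm ∧ T.toLinearMap.index = 0

theorem mapsTo_range_pow (T : X →L[ℂ] X) (n : ℕ) :
    Set.MapsTo T ((T ^ n).range : Set X) ((T ^ n).range : Set X) := by
  rintro _ ⟨y, rfl⟩
  refine ⟨T y, ?_⟩
  change (T ^ n * T) y = (T * T ^ n) y
  rw [← pow_succ, ← pow_succ']

/-- `T_[n]`: the restriction of `T` to `range (T ^ n)`, as an operator from `range (T ^ n)` to
itself. -/
def restrictRangePow (T : X →L[ℂ] X) (n : ℕ) : (T ^ n).range →L[ℂ] (T ^ n).range :=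
  T.restrict (mapsTo_range_pow T n)

/-- Upper semi-B-Weyl: for some `n`, the range of `T ^ n` is closed and `T_[n]` is upper
semi-Fredholm of index `≤ 0`, that is, upper semi-Weyl. -/
def IsUpperSemiBWeyl (T : X →L[ℂ] X) : Prop :=
  ∃ n : ℕ, IsClosed ((T ^ n).range : Set X) ∧ IsUpperSemiWeyl (restrictRangePow T n)

/-- B-Weyl: for some `n`, the range of `T ^ n` is closed and `T_[n]` is Fredholm of index `0`,
that is, Weyl. -/
def IsBWeyl (T : X →L[ℂ] X) : Prop :=
  ∃ n : ℕ, IsClosed ((T ^ n).range : Set X) ∧ IsWeyl (restrictRangePow T n)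

/-- The upper semi-Weyl spectrum `σ_uw(T)`. -/
def upperSemiWeylSpectrum (T : X →L[ℂ] X) : Set ℂ :=
  {z | ¬ IsUpperSemiWeyl (T - z • ContinuousLinearMap.id ℂ X)}

/-- The Weyl spectrum `σ_w(T)`. -/
def weylSpectrum (T : X →L[ℂ] X) : Set ℂ :=
  {z | ¬ IsWeyl (T - z • ContinuousLinearMap.id ℂ X)}

/-- The upper semi-B-Weyl spectrum `σ_ubw(T)`. -/
def upperSemiBWeylSpectrum (T : X →L[ℂ] X) : Set ℂ :=
  {z | ¬ IsUpperSemiBWeyl (T - z • ContinuousLinearMap.id ℂ X)}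

/-- The B-Weyl spectrum `σ_bw(T)`. -/
def bWeylSpectrum (T : X →L[ℂ] X) : Set ℂ :=
  {z | ¬ IsBWeyl (T - z • ContinuousLinearMap.id ℂ X)}

end BWeyl

end

/-! Write `S` for a translate of `T`. If `S` is upper semi-Weyl, it is upper semi-B-Weyl, so
equality of the B-spectra makes some `S_[n]` Weyl. As `S ^ n`, mapped onto its range, intertwines
`S` with `S_[n]` and has finite index, that index cancels and `ind S = ind S_[n] = 0`.

Conversely, let `A = S_[n]` be upper semi-Weyl but not Weyl, so its defect exceeds its nullity. This
excess survives small perturbations (`IsUpperSemiWeyl.exists_forall_sub_smul`): `A - μ` is upper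
semi-Fredholm, with negative index if Fredholm. For `μ ≠ 0`, `S - μ` and `A - μ` have isomorphic
kernels and cokernels (`fredholmIntertwines_powToRange`). So `S - μ` is upper semi-Weyl but not
Weyl, against the equality of the Weyl spectra. -/

open Module

namespace BWeyl

/-! ### Closed range and Fredholm operators -/

section Banach

variable {E F : Type*} [NormedAddCommGroup E] [NormedSpace ℂ E] [CompleteSpace E]
  [NormedAddCommGroup F] [NormedSpace ℂ F] [CompleteSpace F]

/-- Between Banach spaces, an operator with closed range is strict. -/
theorem isStrictMap_of_isClosed_range {T : E →L[ℂ] F} (h : IsClosed (T.range : Set F)) :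
    Topology.IsStrictMap T := by
  have : CompleteSpace T.range := h.completeSpace_coe
  let P : E →L[ℂ] T.range := T.codRestrict T.range fun x => ⟨x, rfl⟩
  have hP : Function.Surjective P := by
    rintro ⟨_, x, rfl⟩
    exact ⟨x, rfl⟩
  exact (Topology.IsEmbedding.subtypeVal.isStrictMap_iff (f := P)).1 (P.isQuotientMap hP).isStrictMap

theorem IsUpperSemiFredholm.isFredholm {T : E →L[ℂ] F} (h : IsUpperSemiFredholm T)
    (hc : FiniteDimensional ℂ (F ⧸ T.range)) : T.IsFredholm where
  isStrictMap := isStrictMap_of_isClosed_range h.isClosed_range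
  isClosed_range := h.isClosed_range
  finite_ker := h.finite_ker
  finite_coker := hc
  closedComplemented_ker :=
    have := h.finite_ker
    .of_finiteDimensional _

end Banach

/-! ### Transfer of kernel, cokernel and index -/

section Intertwining

variable {E F : Type*} [NormedAddCommGroup E] [NormedSpace ℂ E]
  [NormedAddCommGroup F] [NormedSpace ℂ F]

/-- A surjective operator `P` intertwines `S` and `A`, is bijective between their kernels, and
has its own kernel inside the range of `S`. -/
structure FredholmIntertwines (P : E →L[ℂ] F) (S : E →L[ℂ] E) (A : F →L[ℂ] F) : Prop where
  comm : ∀ x, P (S x) = A (P x)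
  surjective : Function.Surjective P
  eq_zero : ∀ x, S x = 0 → P x = 0 → x = 0
  exists_lift : ∀ y, A y = 0 → ∃ x, S x = 0 ∧ P x = y
  ker_le : P.ker ≤ S.range

namespace FredholmIntertwines

variable {P : E →L[ℂ] F} {S : E →L[ℂ] E} {A : F →L[ℂ] F} (h : FredholmIntertwines P S A)
include h

theorem nonempty_kerEquiv : Nonempty (S.ker ≃ₗ[ℂ] A.ker) := by
  let f : S.ker →ₗ[ℂ] A.ker := P.toLinearMap.restrict (p := S.ker) (q := A.ker) fun x hx => by
    have hx : S x = 0 := hx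
    change A (P x) = 0
    rw [← h.comm, hx, map_zero]
  refine ⟨LinearEquiv.ofBijective f ⟨?_, ?_⟩⟩
  · rw [injective_iff_map_eq_zero]
    rintro ⟨x, hx⟩ hfx
    exact Subtype.ext (h.eq_zero x hx (congrArg Subtype.val hfx))
  · rintro ⟨y, hy⟩
    obtain ⟨x, hx, rfl⟩ := h.exists_lift y hy
    exact ⟨⟨x, hx⟩, rfl⟩

/-- If `P x = A (P z) = P (S z)`, then `x - S z` lies in `P.ker ≤ S.range`. This identity carries
both the cokernel and the closedness of the range from `A` back to `S`. -/
theorem comap_range : A.range.comap P.toLinearMap = S.range := by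
  ext x
  constructor
  · rintro ⟨y, hy⟩
    obtain ⟨z, rfl⟩ := h.surjective y
    have hk : x - S z ∈ P.ker := by
      change P (x - S z) = 0
      rw [map_sub, h.comm, sub_eq_zero]
      exact hy.symm
    obtain ⟨w, hw⟩ := h.ker_le hk
    refine ⟨w + z, ?_⟩
    have hw : S w = x - S z := hw
    change S (w + z) = x
    rw [map_add, hw, sub_add_cancel]
  · rintro ⟨z, rfl⟩
    exact ⟨P z, (h.comm z).symm⟩

theorem nonempty_cokerEquiv : Nonempty ((E ⧸ S.range) ≃ₗ[ℂ] (F ⧸ A.range)) := by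
  let f : E →ₗ[ℂ] F ⧸ A.range := A.range.mkQ ∘ₗ P.toLinearMap
  have hf : Function.Surjective f := (Submodule.mkQ_surjective _).comp h.surjective
  have hk : S.range = LinearMap.ker f := by
    rw [LinearMap.ker_comp, Submodule.ker_mkQ, h.comap_range]
  exact ⟨(Submodule.quotEquivOfEq _ _ hk).trans (f.quotKerEquivOfSurjective hf)⟩

theorem index_eq : S.toLinearMap.index = A.toLinearMap.index := by
  obtain ⟨e⟩ := h.nonempty_kerEquiv
  obtain ⟨e'⟩ := h.nonempty_cokerEquiv
  rw [LinearMap.index_eq_finrank_sub, LinearMap.index_eq_finrank_sub, e.finrank_eq, e'.finrank_eq]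

theorem finiteDimensional_coker_iff :
    FiniteDimensional ℂ (E ⧸ S.range) ↔ FiniteDimensional ℂ (F ⧸ A.range) := by
  obtain ⟨e⟩ := h.nonempty_cokerEquiv
  exact ⟨fun _ => e.finiteDimensional, fun _ => e.symm.finiteDimensional⟩

theorem semiFredholmIndex_eq : semiFredholmIndex S = semiFredholmIndex A := by
  classical
  rw [semiFredholmIndex, semiFredholmIndex, h.index_eq]
  exact if_congr h.finiteDimensional_coker_iff rfl rfl

theorem isUpperSemiFredholm (hA : IsUpperSemiFredholm A) : IsUpperSemiFredholm S where
  finite_ker := by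
    obtain ⟨e⟩ := h.nonempty_kerEquiv
    have := hA.finite_ker
    exact e.symm.finiteDimensional
  isClosed_range := by
    rw [← h.comap_range]
    exact hA.isClosed_range.preimage P.continuous

theorem isUpperSemiWeyl (hA : IsUpperSemiWeyl A) : IsUpperSemiWeyl S :=
  ⟨h.isUpperSemiFredholm hA.1, h.semiFredholmIndex_eq ▸ hA.2⟩

end FredholmIntertwines

end Intertwining

/-! ### Comparison of an operator with its restrictions to ranges of powers -/

section Weyl

variable {X : Type*} [NormedAddCommGroup X] [NormedSpace ℂ X]

theorem semiFredholmIndex_eq_index {E F : Type*} [NormedAddCommGroup E] [NormedSpace ℂ E]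
    [NormedAddCommGroup F] [NormedSpace ℂ F] (T : E →L[ℂ] F)
    (hc : FiniteDimensional ℂ (F ⧸ T.range)) :
    semiFredholmIndex T = (T.toLinearMap.index : WithBot ℤ) :=
  if_pos hc

theorem IsWeyl.isUpperSemiWeyl {T : X →L[ℂ] X} (h : IsWeyl T) : IsUpperSemiWeyl T := by
  refine ⟨⟨h.1.finite_ker, h.1.isClosed_range⟩, ?_⟩
  rw [semiFredholmIndex_eq_index T h.1.finite_coker, h.2]
  rfl

theorem IsBWeyl.isUpperSemiBWeyl {T : X →L[ℂ] X} (h : IsBWeyl T) : IsUpperSemiBWeyl T := by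
  obtain ⟨n, hn, hw⟩ := h
  exact ⟨n, hn, hw.isUpperSemiWeyl⟩

theorem IsUpperSemiWeyl.isUpperSemiBWeyl {T : X →L[ℂ] X} (h : IsUpperSemiWeyl T) :
    IsUpperSemiBWeyl T := by
  have htop (x : X) : x ∈ (T ^ 0).range := ⟨x, rfl⟩
  refine ⟨0, ?_, ?_⟩
  · rw [(SetLike.coe_set_eq.2 (Submodule.eq_top_iff'.2 htop)), Submodule.top_coe]
    exact isClosed_univ
  · have hP : FredholmIntertwines (T ^ 0).range.subtypeL (restrictRangePow T 0) T :=
      { comm := fun x => rfl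
        surjective := fun x => ⟨⟨x, htop x⟩, rfl⟩
        eq_zero := fun x _ hx => Subtype.ext hx
        exists_lift := fun y hy => ⟨⟨y, htop y⟩, Subtype.ext hy, rfl⟩
        ker_le := by
          intro x hx
          have : x = 0 := Subtype.ext hx
          rw [this]
          exact zero_mem _ }
    exact hP.isUpperSemiWeyl h

/-- `T ^ n` as an operator from `X` onto its range. -/
def powToRange (T : X →L[ℂ] X) (n : ℕ) : X →L[ℂ] (T ^ n).range :=
  (T ^ n).codRestrict (T ^ n).range fun x => ⟨x, rfl⟩

theorem powToRange_surjective (T : X →L[ℂ] X) (n : ℕ) : Function.Surjective (powToRange T n) := by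
  rintro ⟨_, x, rfl⟩
  exact ⟨x, rfl⟩

theorem powToRange_comm (T : X →L[ℂ] X) (n : ℕ) (x : X) :
    powToRange T n (T x) = restrictRangePow T n (powToRange T n x) := by
  apply Subtype.ext
  change (T ^ n * T) x = (T * T ^ n) x
  rw [← pow_succ, ← pow_succ']

/-- `T ^ n` intertwines `T - μ` and `T_[n] - μ` for `μ ≠ 0`. -/
theorem fredholmIntertwines_powToRange (T : X →L[ℂ] X) (n : ℕ) {μ : ℂ} (hμ : μ ≠ 0) :
    FredholmIntertwines (powToRange T n) (T - μ • ContinuousLinearMap.id ℂ X)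
      (restrictRangePow T n - μ • ContinuousLinearMap.id ℂ (T ^ n).range) := by
  -- On the `μ`-eigenspace `T ^ n` is the nonzero scalar `μ ^ n`, hence a bijection of kernels.
  have hpow (x : X) (hx : T x = μ • x) : (T ^ n) x = μ ^ n • x := by
    induction n with
    | zero => simp
    | succ k ih =>
      rw [pow_succ']
      change T ((T ^ k) x) = _
      rw [ih, map_smul, hx, smul_smul, pow_succ]
  have hμn : μ ^ n ≠ 0 := pow_ne_zero n hμ
  refine ⟨fun x => ?_, powToRange_surjective T n, fun x hx hP => ?_, fun y hy => ?_, fun x hx => ?_⟩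
  · simp [powToRange_comm]
  · have h1 := hpow x (sub_eq_zero.1 hx)
    have h2 : (T ^ n) x = 0 := congrArg Subtype.val hP
    rw [h2] at h1
    exact (smul_eq_zero.1 h1.symm).resolve_left hμn
  · have hT : T (y : X) = μ • (y : X) := sub_eq_zero.1 (congrArg Subtype.val hy)
    refine ⟨(μ ^ n)⁻¹ • (y : X), ?_, Subtype.ext ?_⟩
    · rw [map_smul]
      simp [hT]
    · change (T ^ n) ((μ ^ n)⁻¹ • (y : X)) = y
      rw [map_smul, hpow _ hT, inv_smul_smul₀ hμn]
  · have h2 : (T ^ n) x = 0 := congrArg Subtype.val hx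
    have hc : Commute T (μ • 1) := (Commute.one_right T).smul_right μ
    -- When `T ^ n` kills `x`, this factorization writes `-μ ^ n • x` as a value of `T - μ`.
    obtain ⟨R, hR⟩ : (T - μ • 1) ∣ T ^ n - (μ • 1) ^ n := hc.sub_dvd_pow_sub_pow n
    have hR : (T ^ n) x - (μ ^ n) • x = (T - μ • 1) (R x) := by
      simpa [smul_pow] using congrArg (fun L : X →L[ℂ] X => L x) hR
    refine ⟨-((μ ^ n)⁻¹ • R x), ?_⟩
    change (T - μ • 1) (-((μ ^ n)⁻¹ • R x)) = x
    rw [map_neg, map_smul, ← hR, h2, zero_sub, smul_neg, neg_neg, inv_smul_smul₀ hμn]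

theorem finiteDimensional_ker_pow {V : Type*} [AddCommGroup V] [Module ℂ V] (f : V →ₗ[ℂ] V)
    [FiniteDimensional ℂ (LinearMap.ker f)] (n : ℕ) :
    FiniteDimensional ℂ (LinearMap.ker (f ^ n)) := by
  induction n with
  | zero =>
    rw [pow_zero, Module.End.one_eq_id, LinearMap.ker_id]
    infer_instance
  | succ k ih =>
    rw [pow_succ, Module.End.mul_eq_comp, LinearMap.ker_comp]
    infer_instance

/-- If `A ∘ p = p ∘ f` with `p` surjective with finite-dimensional kernel and `A` has range of
finite codimension, then so has `f`. -/
theorem finiteDimensional_coker_of_comp_eq {V W : Type*} [AddCommGroup V] [Module ℂ V]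
    [AddCommGroup W] [Module ℂ W] {p : V →ₗ[ℂ] W} {f : V →ₗ[ℂ] V} {A : W →ₗ[ℂ] W}
    (h : A ∘ₗ p = p ∘ₗ f) (hp : Function.Surjective p) [FiniteDimensional ℂ (LinearMap.ker p)]
    [FiniteDimensional ℂ (W ⧸ LinearMap.range A)] :
    FiniteDimensional ℂ (V ⧸ LinearMap.range f) := by
  -- The kernel is the preimage of `range A = range (p ∘ f)` under `p`, namely `range f + ker p`.
  have hle : LinearMap.ker ((LinearMap.range A).mkQ ∘ₗ p) ≤
      LinearMap.range f ⊔ LinearMap.ker p := by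
    rw [← Submodule.comap_map_eq, ← LinearMap.range_comp, ← h,
      LinearMap.range_comp_of_range_eq_top A (LinearMap.range_eq_top.2 hp), LinearMap.ker_comp,
      Submodule.ker_mkQ]
  have hco : (LinearMap.range f ⊔ LinearMap.ker p).CoFG :=
    (Submodule.CoFG.ker ((LinearMap.range A).mkQ ∘ₗ p)).of_le hle
  obtain ⟨D, hD⟩ := Submodule.exists_isCompl (LinearMap.range f ⊔ LinearMap.ker p)
  have hDfin : FiniteDimensional ℂ D := .of_fg (hco.fg_of_isCompl hD)
  have htop : LinearMap.range f ⊔ (LinearMap.ker p ⊔ D) = ⊤ := by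
    rw [← sup_assoc, hD.sup_eq_top]
  refine Module.Finite.of_surjective
    ((LinearMap.range f).mkQ ∘ₗ (LinearMap.ker p ⊔ D).subtype) ?_
  rw [← LinearMap.range_eq_top, LinearMap.range_comp, Submodule.range_subtype,
    Submodule.map_mkQ_eq_top, htop]

/-- If `T` is upper semi-Fredholm and `T_[n]` is Weyl, then `T` is Weyl. -/
theorem IsUpperSemiFredholm.isWeyl_of_restrictRangePow [CompleteSpace X] {T : X →L[ℂ] X}
    (hT : IsUpperSemiFredholm T) {n : ℕ} (hn : IsWeyl (restrictRangePow T n)) : IsWeyl T := by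
  let p := (powToRange T n).toLinearMap
  let A := (restrictRangePow T n).toLinearMap
  have hcomm : A ∘ₗ p = p ∘ₗ T.toLinearMap := LinearMap.ext fun x => (powToRange_comm T n x).symm
  have hkerT : FiniteDimensional ℂ (LinearMap.ker T.toLinearMap) := hT.finite_ker
  have hkerA : FiniteDimensional ℂ (LinearMap.ker A) := hn.1.finite_ker
  have hcokA : FiniteDimensional ℂ (_ ⧸ LinearMap.range A) := hn.1.finite_coker
  have hps : Function.Surjective p := powToRange_surjective T n
  have hcokp : FiniteDimensional ℂ (_ ⧸ LinearMap.range p) := by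
    rw [LinearMap.range_eq_top.2 hps]
    infer_instance
  have hkerp : FiniteDimensional ℂ (LinearMap.ker p) := by
    have : LinearMap.ker p = LinearMap.ker (T.toLinearMap ^ n) := by
      ext x
      rw [← ContinuousLinearMap.toLinearMap_pow]
      exact Subtype.ext_iff
    rw [this]
    exact finiteDimensional_ker_pow _ n
  have hcokT : FiniteDimensional ℂ (X ⧸ LinearMap.range T.toLinearMap) :=
    finiteDimensional_coker_of_comp_eq hcomm hps
  refine ⟨hT.isFredholm hcokT, ?_⟩
  -- Both sides of `A ∘ p = p ∘ T` have an additive index, and `ind p` cancels.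
  have h1 := LinearMap.index_comp (f := p) A
  have h2 := LinearMap.index_comp (f := T.toLinearMap) p
  rw [hcomm, h2, hn.2] at h1
  linarith

end Weyl

/-! ### Stability of negative index under small translates -/

section Perturbation

variable {Y : Type*} [NormedAddCommGroup Y] [NormedSpace ℂ Y]

/-- An upper semi-Weyl operator that is not Weyl has a defect exceeding its nullity. -/
theorem IsUpperSemiWeyl.nullity_lt_defect [CompleteSpace Y] {A : Y →L[ℂ] Y}
    (hA : IsUpperSemiWeyl A) (hW : ¬ IsWeyl A) :
    ((finrank ℂ A.ker + 1 : ℕ) : Cardinal) ≤ Module.rank ℂ (Y ⧸ A.range) := by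
  by_cases hc : FiniteDimensional ℂ (Y ⧸ A.range)
  · have h0 : A.toLinearMap.index ≤ 0 := by
      have := hA.2
      rw [semiFredholmIndex_eq_index A hc] at this
      exact_mod_cast this
    have h1 : A.toLinearMap.index ≠ 0 := fun h => hW ⟨hA.1.isFredholm hc, h⟩
    rw [LinearMap.index_eq_finrank_sub] at h0 h1
    rw [← Module.finrank_eq_rank, Nat.cast_le]
    lia
  · have : Cardinal.aleph0 ≤ Module.rank ℂ (Y ⧸ A.range) := by
      rwa [← not_lt, Module.rank_lt_aleph0_iff]
    exact Cardinal.natCast_le_aleph0.trans this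

/-- The index of a map whose restriction to a complement of a `k`-dimensional subspace is
injective, with range avoided by an `m`-dimensional space, is at most `k - m`. -/
theorem index_le_of_injective_restrict {V W U : Type*} [AddCommGroup V] [Module ℂ V]
    [AddCommGroup W] [Module ℂ W] [AddCommGroup U] [Module ℂ U] [FiniteDimensional ℂ U]
    {K Z : Submodule ℂ V} (hKZ : IsCompl K Z) [FiniteDimensional ℂ K]
    (B : V →ₗ[ℂ] W) [FiniteDimensional ℂ (LinearMap.ker B)]
    [FiniteDimensional ℂ (W ⧸ LinearMap.range B)] (g : U →ₗ[ℂ] W)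
    (hinj : ∀ z ∈ Z, ∀ u, B z + g u = 0 → z = 0 ∧ u = 0) :
    B.index ≤ finrank ℂ K - finrank ℂ U := by
  let e : (V ⧸ Z) ≃ₗ[ℂ] K := Submodule.quotientEquivOfIsCompl Z K hKZ.symm
  have hZ : FiniteDimensional ℂ (V ⧸ LinearMap.range Z.subtype) := by
    rw [Submodule.range_subtype]
    exact e.symm.finiteDimensional
  have hkZ : FiniteDimensional ℂ (LinearMap.ker Z.subtype) := by
    rw [Submodule.ker_subtype]
    infer_instance
  have hcomp := LinearMap.index_comp (f := Z.subtype) B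
  have hBZ : Function.Injective (B ∘ₗ Z.subtype) := by
    rw [injective_iff_map_eq_zero]
    intro z hz
    have hz : B z = 0 := hz
    exact Subtype.ext (hinj z z.2 0 (by rw [hz, map_zero, add_zero])).1
  have hcok : FiniteDimensional ℂ (W ⧸ LinearMap.range (B ∘ₗ Z.subtype)) := by
    rw [LinearMap.range_comp]
    infer_instance
  -- `U` embeds in the cokernel of `B` restricted to `Z`; the index of this restriction is `B.index
  -- - finrank K`.
  have hU : finrank ℂ U ≤ finrank ℂ (W ⧸ LinearMap.range (B ∘ₗ Z.subtype)) := by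
    refine LinearMap.finrank_le_finrank_of_injective
      (f := (LinearMap.range (B ∘ₗ Z.subtype)).mkQ ∘ₗ g) ?_
    rw [injective_iff_map_eq_zero]
    intro u hu
    obtain ⟨z, hz⟩ := (Submodule.Quotient.mk_eq_zero _).1 hu
    have hz : B z = g u := hz
    refine (hinj (-z) (Z.neg_mem z.2) u ?_).2
    rw [map_neg, hz, neg_add_cancel]
  rw [LinearMap.index_of_injective hBZ, LinearMap.index_of_injective Z.injective_subtype,
    Submodule.range_subtype, e.finrank_eq] at hcomp
  lia

/-- Small translates of an upper semi-Weyl operator that is not Weyl are upper semi-Fredholm, and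
have negative index when they are Fredholm. -/
theorem IsUpperSemiWeyl.exists_forall_sub_smul [CompleteSpace Y] {A : Y →L[ℂ] Y}
    (hA : IsUpperSemiWeyl A) (hW : ¬ IsWeyl A) :
    ∃ c : ℝ, 0 < c ∧ ∀ μ : ℂ, ‖μ‖ < c →
      IsUpperSemiFredholm (A - μ • ContinuousLinearMap.id ℂ Y) ∧
      (FiniteDimensional ℂ (Y ⧸ (A - μ • ContinuousLinearMap.id ℂ Y).range) →
        (A - μ • ContinuousLinearMap.id ℂ Y).toLinearMap.index < 0) := by
  have hk := hA.1.finite_ker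
  -- With `k` the nullity of `A`, `f` embeds `ℂ ^ (k + 1)` in the cokernel and `g` lifts it to `Y`.
  -- This also covers infinite defect.
  obtain ⟨f, hf⟩ := Module.le_rank_iff_exists_linearMap.1 (hA.nullity_lt_defect hW)
  obtain ⟨g, hg⟩ := Module.projective_lifting_property A.range.mkQ f A.range.mkQ_surjective
  obtain ⟨Z, hZc, hKZ⟩ :=
    (Submodule.ClosedComplemented.of_finiteDimensional A.ker).exists_isClosed_isCompl
  have : CompleteSpace Z := hZc.completeSpace_coe
  have hZco : Z.CoFG :=
    Submodule.FG.cofg_of_isCompl hKZ (Submodule.fg_iff_finiteDimensional _ |>.2 hk)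
  let G := LinearMap.toContinuousLinearMap g
  let Φ := (A ∘L Z.subtypeL).coprod G
  have hrange : Z.map A.toLinearMap = A.range := by
    rw [← Submodule.map_top, ← hKZ.sup_eq_top, Submodule.map_sup]
    rw [LinearMap.le_ker_iff_map.1 le_rfl, bot_sup_eq]
  have hΦinj : Function.Injective Φ := by
    rw [injective_iff_map_eq_zero]
    rintro ⟨z, u⟩ h
    have h : A z + g u = 0 := h
    have hu : u = 0 := by
      apply (injective_iff_map_eq_zero f).1 hf
      rw [← hg]
      refine (Submodule.Quotient.mk_eq_zero _).2 ⟨-(z : Y), ?_⟩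
      change A (-(z : Y)) = g u
      rw [map_neg, eq_comm]
      exact eq_neg_of_add_eq_zero_right h
    rw [hu, map_zero, add_zero] at h
    have hz : (z : Y) = 0 := Submodule.disjoint_def.1 hKZ.disjoint z h z.2
    rw [hu]
    exact Prod.ext (Subtype.ext hz) rfl
  have hΦcl : IsClosed (Set.range Φ) := by
    have : (Φ.range : Set Y) = Set.range Φ := LinearMap.coe_range _
    rw [← this]
    have : Φ.range = A.range ⊔ LinearMap.range g := by
      rw [← hrange]
      refine (LinearMap.range_coprod (A.toLinearMap ∘ₗ Z.subtype) g).trans ?_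
      rw [LinearMap.range_comp, Submodule.range_subtype]
    rw [this]
    exact Submodule.isClosed_sup_finiteDimensional _ _ hA.1.isClosed_range
  -- The lower bound of `Φ (z, u) = A z + g u` is the admissible radius: replacing `A` by `A - μ`
  -- costs at most `‖μ‖`.
  obtain ⟨c, hc, hΦ⟩ := (antilipschitzWith_iff_exists_mul_le_norm (f := Φ)).1
    (Φ.antilipschitz_of_injective_of_isClosed_range hΦinj hΦcl)
  refine ⟨c, hc, fun μ hμ => ?_⟩
  set B := A - μ • ContinuousLinearMap.id ℂ Y with hB
  have hlow (z : Z) (u : Fin (finrank ℂ A.ker + 1) → ℂ) :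
      (c - ‖μ‖) * ‖((z, u) : Z × _)‖ ≤ ‖B z + g u‖ := by
    have h1 : c * ‖((z, u) : Z × _)‖ ≤ ‖A z + g u‖ := hΦ (z, u)
    have h2 : A z + g u = (B z + g u) + μ • (z : Y) := by
      rw [hB]
      simp
      abel
    have h3 : ‖A z + g u‖ ≤ ‖B z + g u‖ + ‖μ‖ * ‖(z : Y)‖ := by
      rw [h2, ← norm_smul]
      exact norm_add_le _ _
    have h4 : ‖μ‖ * ‖(z : Y)‖ ≤ ‖μ‖ * ‖((z, u) : Z × _)‖ :=
      mul_le_mul_of_nonneg_left (norm_fst_le (z, u)) (norm_nonneg _)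
    linarith
  have hpos : 0 < c - ‖μ‖ := sub_pos.2 hμ
  have hinj (z : Y) (hz : z ∈ Z) (u : Fin (finrank ℂ A.ker + 1) → ℂ) (h : B z + g u = 0) :
      z = 0 ∧ u = 0 := by
    have h1 := hlow ⟨z, hz⟩ u
    rw [h, norm_zero] at h1
    have h2 : ((⟨z, hz⟩, u) : Z × _) = 0 :=
      norm_le_zero_iff.1 (nonpos_of_mul_nonpos_right h1 hpos)
    exact ⟨congrArg (fun w => (w.1 : Y)) h2, congrArg Prod.snd h2⟩
  have hker : FiniteDimensional ℂ B.ker := by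
    rw [← Submodule.fg_iff_finiteDimensional]
    refine hZco.fg_of_disjoint (Submodule.disjoint_def.2 fun z hBz hz => ?_)
    have hBz : B z = 0 := hBz
    exact (hinj z hz 0 (by rw [hBz, map_zero, add_zero])).1
  -- `B` is bounded below on `Z`, so `B Z` is closed; `Z` has finite codimension, so the full range
  -- is closed too.
  have hcl : IsClosed (B.range : Set Y) := by
    refine LinearMap.isClosed_range_of_isClosed_map_of_finiteDimensional_quotient (s := Z) ?_
    obtain ⟨K, hK⟩ := (antilipschitzWith_iff_exists_mul_le_norm (f := B ∘L Z.subtypeL)).2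
      ⟨c - ‖μ‖, hpos, fun z => by
        have := hlow z 0
        rw [map_zero, add_zero] at this
        exact (mul_le_mul_of_nonneg_left (norm_fst_le (z, 0)) hpos.le).trans this⟩
    convert hK.isClosed_range (B ∘L Z.subtypeL).uniformContinuous using 1
    rw [Submodule.map_coe, ContinuousLinearMap.coe_comp, Set.range_comp]
    simp
  refine ⟨⟨hker, hcl⟩, fun hfin => ?_⟩
  -- The bound is `k - (k + 1) = -1`.
  have := index_le_of_injective_restrict hKZ B.toLinearMap g hinj
  rw [Module.finrank_fin_fun] at this
  push_cast at this
  linarith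

end Perturbation

/-! ### The two implications -/

theorem sub_smul_id_sub_smul_id {X : Type*} [NormedAddCommGroup X] [NormedSpace ℂ X]
    (T : X →L[ℂ] X) (z μ : ℂ) :
    T - z • ContinuousLinearMap.id ℂ X - μ • ContinuousLinearMap.id ℂ X =
      T - (z + μ) • ContinuousLinearMap.id ℂ X := by
  rw [add_smul, sub_sub]

/-- If every translate of `S` that is upper semi-Weyl is Weyl and `S` is upper semi-B-Weyl, then
`S` is B-Weyl. -/
theorem IsUpperSemiBWeyl.isBWeyl {X : Type*} [NormedAddCommGroup X] [NormedSpace ℂ X]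
    [CompleteSpace X] {S : X →L[ℂ] X} (hS : IsUpperSemiBWeyl S)
    (h : ∀ μ : ℂ, IsUpperSemiWeyl (S - μ • ContinuousLinearMap.id ℂ X) →
      IsWeyl (S - μ • ContinuousLinearMap.id ℂ X)) : IsBWeyl S := by
  obtain ⟨n, hn, hA⟩ := hS
  refine ⟨n, hn, ?_⟩
  by_contra hW
  have : CompleteSpace (S ^ n).range := hn.completeSpace_coe
  obtain ⟨c, hc, hB⟩ := hA.exists_forall_sub_smul hW
  -- Small for the perturbation bound, nonzero for the intertwining.
  obtain ⟨μ, hμ0, hμc⟩ := NormedField.exists_norm_lt ℂ hc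
  obtain ⟨hF, hidx⟩ := hB μ hμc
  have hI := fredholmIntertwines_powToRange S n (norm_pos_iff.1 hμ0)
  have hSW : IsUpperSemiWeyl (S - μ • ContinuousLinearMap.id ℂ X) := by
    refine ⟨hI.isUpperSemiFredholm hF, ?_⟩
    by_cases hfin : FiniteDimensional ℂ (X ⧸ (S - μ • ContinuousLinearMap.id ℂ X).range)
    · rw [semiFredholmIndex_eq_index _ hfin, hI.index_eq]
      exact_mod_cast (hidx (hI.finiteDimensional_coker_iff.1 hfin)).le
    · rw [semiFredholmIndex, if_neg hfin]
      exact bot_le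
  have hSw := h μ hSW
  have := hidx (hI.finiteDimensional_coker_iff.1 hSw.1.finite_coker)
  rw [← hI.index_eq, hSw.2] at this
  exact lt_irrefl _ this

end BWeyl

theorem mainTheorem10 {X : Type*} [NormedAddCommGroup X] [NormedSpace ℂ X] [CompleteSpace X]
    (T : X →L[ℂ] X) :
    BWeyl.upperSemiWeylSpectrum T = BWeyl.weylSpectrum T ↔
      BWeyl.upperSemiBWeylSpectrum T = BWeyl.bWeylSpectrum T := by
  constructor
  · intro h
    ext z
    refine not_congr ⟨fun hS => hS.isBWeyl fun μ hμ => ?_, fun hS => hS.isUpperSemiBWeyl⟩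
    rw [BWeyl.sub_smul_id_sub_smul_id] at hμ ⊢
    exact (not_iff_not.1 (Set.ext_iff.1 h (z + μ))).1 hμ
  · intro h
    ext z
    refine not_congr ⟨fun hS => ?_, fun hS => hS.isUpperSemiWeyl⟩
    obtain ⟨n, -, hn⟩ := (not_iff_not.1 (Set.ext_iff.1 h z)).1 hS.isUpperSemiBWeyl
    exact hS.1.isWeyl_of_restrictRangePow hn
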